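/- Let $0<\omega\le 2\pi$ and let $\Omega=\{(r\cos\varphi,r\sin\varphi)\in\mathbb R^2 : 0<r<1,\ 0<\varphi<\omega\}$ be the circular sector of angle $\omega$. For $k\in\mathbb N_0$ put $\nu_k=k\pi/\omega$, let $$J_\nu(z)=\sum_{j=0}^\infty \frac{(-1)^j}{j!\,\Gamma(\nu+j+1)}\Big(\frac z2\Big)^{2j+\nu}$$ be the Bessel function of the first kind, and for an integer $m\ge1$ let $\mu_{\nu_k,m}$ be the $m$-th positive zero of $J_{\nu_k}$ in increasing order. Let $u_{\nu_k,m}$ be the function on $\Omega$ (a Laplace eigenfunction of the sector) given in polar coordinates by $$u_{\nu_k,m}(r,\varphi)=J_{\nu_k}(\mu_{\nu_k,m}\,r)\cos(\nu_k\varphi).$$ For real $s\ge0$ write $s=l+\sigma$ with $l=\lfloor s\rfloor$. If $\sigma=0$, let $H^s(\Omega)$ be the classical Sobolev space of functions in $L^2(\Omega)$ whose weak derivatives of order at most $l$ are in $L^2(\Omega)$. If $0<\sigma<1$, let $H^s(\Omega)$ be the Sobolev–Slobodeckij space of all $u\in H^l(\Omega)$ with $$\int_\Omega\int_\Omega \frac{|D^\alpha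 u(x)-D^\alpha u(y)|^2}{|x-y|^{2+2\sigma}}\,dx\,dy<\infty$$ for every multi-index $\alpha$ of order $l$. Then, for all $k\in\mathbb N_0$ and all integers $m\ge1$: 1. $u_{\nu_k,m}\in H^s(\Omega)$ for all real $s\ge 0$ if and only if $\nu_k=k\pi/\omega\in\mathbb N_0$. 2. If $\nu_k\notin\mathbb N_0$, then $u_{\nu_k,m}\notin H^s(\Omega)$ for every real $s\ge\nu_k+1$; that is, the bound $s<\nu_k+1$ in the regularity result "$u_{\nu_k,m}\in H^s(\Omega)$ for all $0\le s<\nu_k+1$" cannot be relaxed. -/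

import Mathlib

open MeasureTheory

noncomputable section

/-! ### Sobolev and Sobolev–Slobodeckij spaces on an open subset of `ℝᵈ` -/

/-- `g` is the weak partial derivative `∂_{ι 0} ⋯ ∂_{ι (l-1)} u` on the open set `Ω ⊆ ℝᵈ`:
both functions are locally integrable on `Ω`, and
`∫_Ω u · ∂_{ι 0} ⋯ ∂_{ι (l-1)} φ = (-1)^l ∫_Ω g · φ` for all smooth `φ` with compact support in `Ω`.
A multi-index `α` of order `l` is encoded by a list `ι : Fin l → Fin d` of coordinate directions
(the direction `i` occurring `α i` times; the order is immaterial). -/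
def IsWeakPartialDeriv {d l : ℕ} (Ω : Set (EuclideanSpace ℝ (Fin d))) (ι : Fin l → Fin d)
    (u g : EuclideanSpace ℝ (Fin d) → ℝ) : Prop :=
  LocallyIntegrableOn u Ω volume ∧ LocallyIntegrableOn g Ω volume ∧
  ∀ φ : EuclideanSpace ℝ (Fin d) → ℝ, ContDiff ℝ (⊤ : ℕ∞) φ → HasCompactSupport φ →
    tsupport φ ⊆ Ω →
    ∫ x in Ω, u x * iteratedFDeriv ℝ l φ x (fun i => EuclideanSpace.single (ι i) (1 : ℝ))
      = (-1) ^ l * ∫ x in Ω, g x * φ x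

/-- The classical Sobolev space `H^l(Ω)`, `l ∈ ℕ₀`: functions in `L²(Ω)` all of whose weak partial
derivatives of order at most `l` exist and belong to `L²(Ω)`. -/
def MemSobolevNat {d : ℕ} (l : ℕ) (Ω : Set (EuclideanSpace ℝ (Fin d)))
    (u : EuclideanSpace ℝ (Fin d) → ℝ) : Prop :=
  MemLp u 2 (volume.restrict Ω) ∧
  ∀ j ≤ l, ∀ ι : Fin j → Fin d,
    ∃ g : EuclideanSpace ℝ (Fin d) → ℝ,
      IsWeakPartialDeriv Ω ι u g ∧ MemLp g 2 (volume.restrict Ω)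

/-- The square of the Slobodeckij seminorm of order `σ`,
`∫_Ω ∫_Ω |g(x) - g(y)|² / |x - y|^{d + 2σ} dy dx`, with values in `[0, ∞]`. -/
def slobodeckijEnergy {d : ℕ} (σ : ℝ) (Ω : Set (EuclideanSpace ℝ (Fin d)))
    (g : EuclideanSpace ℝ (Fin d) → ℝ) : ENNReal :=
  ∫⁻ x in Ω, ∫⁻ y in Ω, ENNReal.ofReal (|g x - g y| ^ 2 / ‖x - y‖ ^ ((d : ℝ) + 2 * σ))

/-- The space `H^s(Ω)` for real `s ≥ 0`. With `l = ⌊s⌋` and `σ = s - l`, it is the classical Sobolev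
space `H^l(Ω)` if `s` is an integer (`σ = 0`), and otherwise (`0 < σ < 1`) the Sobolev–Slobodeckij
space of all `u ∈ H^l(Ω)` whose weak derivatives of order `l` have finite Slobodeckij seminorm of
order `σ`. -/
def MemSobolevSlobodeckij {d : ℕ} (s : ℝ) (Ω : Set (EuclideanSpace ℝ (Fin d)))
    (u : EuclideanSpace ℝ (Fin d) → ℝ) : Prop :=
  MemSobolevNat ⌊s⌋₊ Ω u ∧
  (s ≠ (⌊s⌋₊ : ℝ) → ∀ ι : Fin ⌊s⌋₊ → Fin d,
    ∃ g : EuclideanSpace ℝ (Fin d) → ℝ,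
      IsWeakPartialDeriv Ω ι u g ∧ MemLp g 2 (volume.restrict Ω) ∧
      slobodeckijEnergy (s - (⌊s⌋₊ : ℝ)) Ω g < ⊤)

/-! ### Bessel functions of the first kind and their positive zeros -/

/-- The Bessel function of the first kind `J_ν(z)` for real order `ν ≥ 0` and real `z ≥ 0`. -/
def besselJ (ν z : ℝ) : ℝ :=
  ∑' j : ℕ, (-1) ^ j / ((Nat.factorial j : ℝ) * Real.Gamma (ν + (j : ℝ) + 1))
    * (z / 2) ^ (2 * (j : ℝ) + ν)

/-- `μ` is the `m`-th positive zero of `f` in increasing order, `m ≥ 1`: it is a positive zero, and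
there are exactly `m` zeros of `f` in `(0, μ]`. -/
def IsNthPosZero (f : ℝ → ℝ) (m : ℕ) (μ : ℝ) : Prop :=
  0 < μ ∧ f μ = 0 ∧ {x : ℝ | 0 < x ∧ x ≤ μ ∧ f x = 0}.encard = (m : ℕ∞)

/-- There is at most one `m`-th positive zero. -/
theorem IsNthPosZero.unique {f : ℝ → ℝ} {m : ℕ} {μ₁ μ₂ : ℝ}
    (h₁ : IsNthPosZero f m μ₁) (h₂ : IsNthPosZero f m μ₂) : μ₁ = μ₂ := by
  have key : ∀ {a b : ℝ}, IsNthPosZero f m a → IsNthPosZero f m b → ¬ a < b := by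
    intro a b ha hb hab
    have hsub : {x : ℝ | 0 < x ∧ x ≤ a ∧ f x = 0} ⊂ {x : ℝ | 0 < x ∧ x ≤ b ∧ f x = 0} := by
      refine ⟨fun x hx => ⟨hx.1, hx.2.1.trans hab.le, hx.2.2⟩, fun h => ?_⟩
      have hmem : b ∈ {x : ℝ | 0 < x ∧ x ≤ a ∧ f x = 0} := h ⟨hb.1, le_refl b, hb.2.1⟩
      exact absurd hmem.2.1 (not_le.mpr hab)
    have hfin : {x : ℝ | 0 < x ∧ x ≤ a ∧ f x = 0}.Finite :=
      Set.finite_of_encard_eq_coe ha.2.2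
    have hlt := hfin.encard_lt_encard hsub
    rw [ha.2.2, hb.2.2] at hlt
    exact lt_irrefl _ hlt
  exact le_antisymm (not_lt.mp (key h₂ h₁)) (not_lt.mp (key h₁ h₂))

open Classical in
/-- The `m`-th positive zero `μ_{ν,m}` of `J_ν`, for `ν ≥ 0` and `m ≥ 1`. It exists, since `J_ν` has
infinitely many positive zeros and they do not accumulate at a finite point; the value chosen
in the `else` branch is a junk value for other arguments such as `m = 0`. -/
def besselZero (ν : ℝ) (m : ℕ) : ℝ :=
  if h : ∃ μ : ℝ, IsNthPosZero (besselJ ν) m μ then h.choose else 1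

/-! ### Circular sectors and their Laplace eigenfunctions -/

/-- The open circular sector `{(r cos φ, r sin φ) : 0 < r < 1, 0 < φ < ω}`. -/
def circularSector (ω : ℝ) : Set (EuclideanSpace ℝ (Fin 2)) :=
  {x | ∃ r φ : ℝ, 0 < r ∧ r < 1 ∧ 0 < φ ∧ φ < ω ∧ x = !₂[r * Real.cos φ, r * Real.sin φ]}

/-- The polar angle in `[0, 2π)` of a point of the plane. -/
def polarAngle (x : EuclideanSpace ℝ (Fin 2)) : ℝ :=
  toIcoMod Real.two_pi_pos 0 (Complex.arg ⟨x 0, x 1⟩)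

/-- `ν_k = k π / ω`. -/
def angularFreq (ω : ℝ) (k : ℕ) : ℝ := (k : ℝ) * (Real.pi / ω)

/-- The Laplace eigenfunction `u_{ν_k,m}` of the circular sector of angle `ω`, given in polar
coordinates by `J_{ν_k}(μ_{ν_k,m} r) cos(ν_k φ)`. -/
def sectorEigenfunction (ω : ℝ) (k m : ℕ) (x : EuclideanSpace ℝ (Fin 2)) : ℝ :=
  besselJ (angularFreq ω k) (besselZero (angularFreq ω k) m * ‖x‖)
    * Real.cos (angularFreq ω k * polarAngle x)

theorem norm_polar {r : ℝ} (hr : 0 ≤ r) (φ : ℝ) :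
    ‖(!₂[r * Real.cos φ, r * Real.sin φ] : EuclideanSpace ℝ (Fin 2))‖ = r := by
  rw [EuclideanSpace.norm_eq, Fin.sum_univ_two]
  have : ‖(!₂[r * Real.cos φ, r * Real.sin φ] : EuclideanSpace ℝ (Fin 2)) 0‖ ^ 2
      + ‖(!₂[r * Real.cos φ, r * Real.sin φ] : EuclideanSpace ℝ (Fin 2)) 1‖ ^ 2 = r ^ 2 := by
    simp only [Real.norm_eq_abs, sq_abs]
    simp
    nlinarith [Real.sin_sq_add_cos_sq φ]
  rw [this, Real.sqrt_sq hr]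

theorem polarAngle_polar {r φ : ℝ} (hr : 0 < r) (h0 : 0 ≤ φ) (h1 : φ < 2 * Real.pi) :
    polarAngle !₂[r * Real.cos φ, r * Real.sin φ] = φ := by
  have hz : (⟨r * Real.cos φ, r * Real.sin φ⟩ : ℂ)
      = (r : ℂ) * (Complex.cos φ + Complex.sin φ * Complex.I) := by
    apply Complex.ext <;> simp [← Complex.ofReal_cos, ← Complex.ofReal_sin]
  have harg : Complex.arg ⟨r * Real.cos φ, r * Real.sin φ⟩
      = toIocMod Real.two_pi_pos (-Real.pi) φ := by
    rw [hz, Complex.arg_mul_cos_add_sin_mul_I_eq_toIocMod hr]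
  unfold polarAngle
  change toIcoMod Real.two_pi_pos 0 (Complex.arg ⟨r * Real.cos φ, r * Real.sin φ⟩) = φ
  rw [harg, toIocMod, toIcoMod_sub_zsmul]
  exact (toIcoMod_eq_self Real.two_pi_pos).2 ⟨h0, by simpa using h1⟩

/-- The eigenfunction in polar coordinates. -/
theorem sectorEigenfunction_polar (ω : ℝ) (k m : ℕ) {r φ : ℝ} (hr : 0 < r) (h0 : 0 ≤ φ)
    (h1 : φ < 2 * Real.pi) :
    sectorEigenfunction ω k m !₂[r * Real.cos φ, r * Real.sin φ]
      = besselJ (angularFreq ω k) (besselZero (angularFreq ω k) m * r)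
        * Real.cos (angularFreq ω k * φ) := by
  rw [sectorEigenfunction, norm_polar hr.le, polarAngle_polar hr h0 h1]

end

/-! Write `z = x + iy`. Factoring `r ^ ν` out of the Bessel series gives `J_ν(μ r) = r ^ ν F(r²)`
with `F` entire and `F(0) ≠ 0`. So, where the polar angle is the principal argument, `u = Re (z ^ ν
Q)` with `Q(z) = F(|z|²)` smooth. Only `μ > 0` matters, not that `μ` is a Bessel zero.

If `ν` is a natural number, `Re (z ^ ν)` is a polynomial. Then `u` is smooth on the whole plane and
lies in every `H^s` of a bounded set (`contDiff_besselJ_mul_cos`, `ContDiff.memSobolevSlobodeckij`).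

If `ν ∉ ℕ₀` and `s ≥ ν + 1`, put `l = ⌊s⌋ > ν` and `a = ν - l < 0`. Each `∂₁` lowers the exponent by
one and multiplies the coefficient at the origin by the current exponent, so `∂₁ˡ u = Re (z ^ a P)`
with `P(0) = ν(ν - 1)⋯(ν - l + 1) F(0) ≠ 0`. In a narrow cone at the vertex this is comparable with
`|z| ^ a`, and any weak derivative agrees with it there almost everywhere. If `s = l`, then `a ≤ -1`
and the square is not integrable. Otherwise `σ = s - l ≥ a + 1`, and comparing values at `x` and at
points of norm about `M|x|` bounds the Slobodeckij energy below by a multiple of `∫ |x| ^ (-2)`.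
Both cases end in the divergence of this integral over a plane cone
(`lintegral_planeCone_inter_ball_norm_rpow_neg_two`). -/

open scoped Topology

/-! ### Iterated classical partial derivatives and integration by parts -/

/-- The classical iterated partial derivative along the list `ι` of coordinate directions. -/
noncomputable def multiPartialDeriv {d : ℕ} : (l : ℕ) → (Fin l → Fin d) → (EuclideanSpace ℝ (Fin d) → ℝ) →
    EuclideanSpace ℝ (Fin d) → ℝ
  | 0, _, f => f
  | l + 1, ι, f => multiPartialDeriv l (Fin.tail ι)
      fun x => fderiv ℝ f x (EuclideanSpace.single (ι 0) 1)

theorem ContDiffOn.fderiv_apply_const {E : Type*} [NormedAddCommGroup E] [NormedSpace ℝ E]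
    {Ω : Set E} {f : E → ℝ} (hΩ : IsOpen Ω) (hf : ContDiffOn ℝ (⊤ : ℕ∞) f Ω) (v : E) :
    ContDiffOn ℝ (⊤ : ℕ∞) (fun x => fderiv ℝ f x v) Ω :=
  (hf.fderiv_of_isOpen hΩ (m := ((⊤ : ℕ∞) : WithTop ℕ∞)) le_rfl).clm_apply contDiffOn_const

theorem ContDiffOn.multiPartialDeriv {d l : ℕ} {Ω : Set (EuclideanSpace ℝ (Fin d))}
    (hΩ : IsOpen Ω) (ι : Fin l → Fin d) {f : EuclideanSpace ℝ (Fin d) → ℝ}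
    (hf : ContDiffOn ℝ (⊤ : ℕ∞) f Ω) : ContDiffOn ℝ (⊤ : ℕ∞) (multiPartialDeriv l ι f) Ω := by
  induction l generalizing f with
  | zero => exact hf
  | succ l ih => exact ih _ (hf.fderiv_apply_const hΩ _)

theorem integrable_mul_of_continuousOn_of_tsupport_subset {E : Type*} [TopologicalSpace E]
    [T2Space E] [MeasurableSpace E] [BorelSpace E] {μ : Measure E} [IsFiniteMeasureOnCompacts μ]
    {Ω : Set E} {f φ : E → ℝ} (hf : ContinuousOn f Ω) (hφ : Continuous φ)
    (hc : HasCompactSupport φ) (hs : tsupport φ ⊆ Ω) : Integrable (fun x => f x * φ x) μ := by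
  have h : IntegrableOn (fun x => f x * φ x) (tsupport φ) μ :=
    ((hf.mono hs).mul hφ.continuousOn).integrableOn_compact hc
  refine (integrableOn_iff_integrable_of_support_subset fun x hx => ?_).1 h
  exact subset_tsupport φ (right_ne_zero_of_mul hx)

theorem tsupport_iteratedFDeriv_apply_subset {E : Type*} [NormedAddCommGroup E]
    [NormedSpace ℝ E] {l : ℕ} {φ : E → ℝ} (w : Fin l → E) :
    tsupport (fun x => iteratedFDeriv ℝ l φ x w) ⊆ tsupport φ :=
  (tsupport_comp_subset (g := fun L : ContinuousMultilinearMap ℝ (fun _ : Fin l => E) ℝ => L w)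
    rfl _).trans (tsupport_iteratedFDeriv_subset l)

/-- One derivative at a time is moved from `φ` to `u`: the outermost derivative of `φ`, along `ι 0`,
is the first to fall on `u`. The values of `u` off `Ω` play no role, since every product vanishes
outside `tsupport φ`. -/
theorem integral_mul_iteratedFDeriv_eq {d l : ℕ} {Ω : Set (EuclideanSpace ℝ (Fin d))}
    (hΩ : IsOpen Ω) (ι : Fin l → Fin d) {u φ : EuclideanSpace ℝ (Fin d) → ℝ}
    (hu : ContDiffOn ℝ (⊤ : ℕ∞) u Ω) (hφ : ContDiff ℝ (⊤ : ℕ∞) φ) (hc : HasCompactSupport φ)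
    (hs : tsupport φ ⊆ Ω) :
    ∫ x, u x * iteratedFDeriv ℝ l φ x (fun i => EuclideanSpace.single (ι i) (1 : ℝ))
      = (-1) ^ l * ∫ x, multiPartialDeriv l ι u x * φ x := by
  induction l generalizing u with
  | zero => simp [multiPartialDeriv]
  | succ l ih =>
    set v : EuclideanSpace ℝ (Fin d) := EuclideanSpace.single (ι 0) (1 : ℝ) with hv
    set w : Fin l → EuclideanSpace ℝ (Fin d) :=
      fun i => EuclideanSpace.single (Fin.tail ι i) (1 : ℝ) with hw
    set ψ : EuclideanSpace ℝ (Fin d) → ℝ := fun x => iteratedFDeriv ℝ l φ x w with hψ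
    have hψd : ContDiff ℝ (⊤ : ℕ∞) ψ :=
      (ContinuousMultilinearMap.apply ℝ (fun _ : Fin l => EuclideanSpace ℝ (Fin d)) ℝ
        w).contDiff.comp (hφ.iteratedFDeriv_right (m := ((⊤ : ℕ∞) : WithTop ℕ∞)) (by
          norm_cast))
    have hψt : tsupport ψ ⊆ tsupport φ := tsupport_iteratedFDeriv_apply_subset w
    have hψc : HasCompactSupport ψ := hc.of_isClosed_subset isClosed_closure hψt
    have hψs := hψt.trans hs
    have hdψ : ∀ x, iteratedFDeriv ℝ (l + 1) φ x
        (fun i => EuclideanSpace.single (ι i) (1 : ℝ)) = fderiv ℝ ψ x v := fun x => by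
      rw [iteratedFDeriv_succ_apply_left, hψ,
        fderiv_continuousMultilinear_apply_const_apply]
      · rfl
      · exact (hφ.differentiable_iteratedFDeriv (by exact_mod_cast ENat.natCast_lt_top l)) x
    have hu' := hu.fderiv_apply_const hΩ v
    have hdu : ∀ x ∈ Ω, DifferentiableAt ℝ u x := fun x hx =>
      (hu.contDiffAt (hΩ.mem_nhds hx)).differentiableAt (by simp)
    simp_rw [hdψ]
    rw [integral_mul_fderiv_eq_neg_fderiv_mul_of_integrable
      (integrable_mul_of_continuousOn_of_tsupport_subset hu'.continuousOn hψd.continuous hψc hψs)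
      (integrable_mul_of_continuousOn_of_tsupport_subset hu.continuousOn
        ((hψd.continuous_fderiv (by simp)).clm_apply continuous_const)
        (hψc.fderiv_apply ℝ v) ((tsupport_fderiv_apply_subset ℝ v).trans hψs))
      (integrable_mul_of_continuousOn_of_tsupport_subset hu.continuousOn hψd.continuous hψc hψs)
      (fun x hx => hdu x (hψs hx)) (fun x _ => hψd.differentiable (by simp) x)]
    rw [hψ, ih (Fin.tail ι) hu', pow_succ]
    simp [multiPartialDeriv, hv]

theorem setIntegral_mul_eq_integral_of_tsupport_subset {E : Type*} [TopologicalSpace E]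
    [MeasurableSpace E] {μ : Measure E} {Ω : Set E} {f φ : E → ℝ} (hs : tsupport φ ⊆ Ω) :
    ∫ x in Ω, f x * φ x ∂μ = ∫ x, f x * φ x ∂μ :=
  setIntegral_eq_integral_of_forall_compl_eq_zero fun x hx => by
    rw [image_eq_zero_of_notMem_tsupport fun h => hx (hs h), mul_zero]

/-- A smooth function on `ℝᵈ` has its classical derivatives as weak derivatives on any set. -/
theorem ContDiff.isWeakPartialDeriv {d l : ℕ} (Ω : Set (EuclideanSpace ℝ (Fin d)))
    (ι : Fin l → Fin d) {u : EuclideanSpace ℝ (Fin d) → ℝ} (hu : ContDiff ℝ (⊤ : ℕ∞) u) :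
    IsWeakPartialDeriv Ω ι u (multiPartialDeriv l ι u) := by
  have hu' : ContDiffOn ℝ (⊤ : ℕ∞) u Set.univ := hu.contDiffOn
  have hg := (hu'.multiPartialDeriv isOpen_univ ι).continuousOn
  rw [continuousOn_univ] at hg
  refine ⟨hu.continuous.locallyIntegrable.locallyIntegrableOn Ω,
    hg.locallyIntegrable.locallyIntegrableOn Ω, fun φ hφ hc hs => ?_⟩
  rw [setIntegral_mul_eq_integral_of_tsupport_subset hs,
    setIntegral_mul_eq_integral_of_tsupport_subset
      ((tsupport_iteratedFDeriv_apply_subset _).trans hs)]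
  exact integral_mul_iteratedFDeriv_eq isOpen_univ ι hu' hφ hc (Set.subset_univ _)

/-- Where a function agrees with a smooth one, its weak derivatives are the classical ones. -/
theorem IsWeakPartialDeriv.ae_eq_multiPartialDeriv {d l : ℕ}
    {Ω Ω' : Set (EuclideanSpace ℝ (Fin d))} {ι : Fin l → Fin d}
    {u g U : EuclideanSpace ℝ (Fin d) → ℝ} (h : IsWeakPartialDeriv Ω ι u g)
    (hΩ' : IsOpen Ω') (hsub : Ω' ⊆ Ω) (hU : ContDiffOn ℝ (⊤ : ℕ∞) U Ω') (huU : Set.EqOn u U Ω') :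
    ∀ᵐ x, x ∈ Ω' → g x = multiPartialDeriv l ι U x := by
  have hcont := (hU.multiPartialDeriv hΩ' ι).continuousOn
  have hgl : LocallyIntegrableOn g Ω' := h.2.1.mono_set hsub
  have hpl : LocallyIntegrableOn (multiPartialDeriv l ι U) Ω' :=
    hcont.locallyIntegrableOn hΩ'.measurableSet
  -- Fundamental lemma of the calculus of variations on `Ω'`. Test functions supported in `Ω'` are
  -- also admissible on `Ω`, so `Ω` itself need not be open.
  have key := hΩ'.ae_eq_zero_of_integral_contDiff_smul_eq_zero
    (f := fun x => g x - multiPartialDeriv l ι U x) (hgl.sub hpl) fun φ hφ hc hs => ?_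
  · filter_upwards [key] with x hx hxm
    exact sub_eq_zero.1 (hx hxm)
  · have h1 := h.2.2 φ hφ hc (hs.trans hsub)
    have hts := tsupport_iteratedFDeriv_apply_subset (φ := φ)
      (fun i => EuclideanSpace.single (ι i) (1 : ℝ))
    rw [setIntegral_mul_eq_integral_of_tsupport_subset (hs.trans hsub),
      setIntegral_mul_eq_integral_of_tsupport_subset (hts.trans (hs.trans hsub))] at h1
    have h2 := integral_mul_iteratedFDeriv_eq hΩ' ι hU hφ hc hs
    have h3 : ∫ x, u x * iteratedFDeriv ℝ l φ x (fun i => EuclideanSpace.single (ι i) (1 : ℝ))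
        = ∫ x, U x * iteratedFDeriv ℝ l φ x (fun i => EuclideanSpace.single (ι i) (1 : ℝ)) := by
      refine integral_congr_ae (.of_forall fun x => ?_)
      by_cases hx : x ∈ Ω'
      · simp only [huU hx]
      · have : iteratedFDeriv ℝ l φ x (fun i => EuclideanSpace.single (ι i) (1 : ℝ)) = 0 :=
          image_eq_zero_of_notMem_tsupport
            (f := fun x => iteratedFDeriv ℝ l φ x (fun i => EuclideanSpace.single (ι i) (1 : ℝ)))
            fun hx' => hx (hs (hts hx'))
        simp only [this, mul_zero]
    rw [h1, h2] at h3
    have h4 := mul_left_cancel₀ (pow_ne_zero l (by norm_num : (-1 : ℝ) ≠ 0)) h3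
    have hgi : Integrable fun x => g x * φ x := by
      have : IntegrableOn (fun x => g x * φ x) (tsupport φ) :=
        (hgl.integrableOn_compact_subset hs hc).mul_continuousOn hφ.continuous.continuousOn hc
      exact (integrableOn_iff_integrable_of_support_subset fun x hx =>
        subset_tsupport φ (right_ne_zero_of_mul hx)).1 this
    have hpi := integrable_mul_of_continuousOn_of_tsupport_subset (μ := volume) hcont
      hφ.continuous hc hs
    simp_rw [smul_eq_mul, mul_comm (φ _), sub_mul]
    rw [integral_sub hgi hpi, h4, sub_self]

/-! ### Smooth functions belong to all spaces `H^s` on bounded sets -/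

/-- In polar coordinates the integrand becomes `t ^ (dim E - 1 + a)`, integrable at `0` exactly when
`a > -dim E`. -/
theorem lintegral_ball_norm_rpow_lt_top {E : Type*} [NormedAddCommGroup E] [NormedSpace ℝ E]
    [FiniteDimensional ℝ E] [Nontrivial E] [MeasurableSpace E] [BorelSpace E] (μ : Measure E)
    [μ.IsAddHaarMeasure] {a : ℝ} (ha : -(Module.finrank ℝ E : ℝ) < a) (R : ℝ) :
    ∫⁻ z in Metric.ball (0 : E) R, ENNReal.ofReal (‖z‖ ^ a) ∂μ < ⊤ := by
  have h : IntegrableOn (fun z : E => ‖z‖ ^ a) (Metric.ball 0 R) μ := by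
    rw [integrableOn_fun_norm_addHaar μ (f := fun t : ℝ => t ^ a)]
    have hd : 1 ≤ Module.finrank ℝ E := Module.finrank_pos
    rcases le_or_gt R 0 with hR | hR
    · simp [Set.Ioo_eq_empty_of_le hR]
    have h1 : IntegrableOn (fun y : ℝ => y ^ ((Module.finrank ℝ E : ℝ) - 1 + a)) (Set.Ioo 0 R) :=
      (intervalIntegral.integrableOn_Ioo_rpow_iff hR).2 (by linarith)
    refine h1.congr_fun (fun y hy => ?_) measurableSet_Ioo
    simp only [smul_eq_mul]
    rw [Real.rpow_add hy.1, ← Real.rpow_natCast, Nat.cast_sub hd, Nat.cast_one]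
  exact (hasFiniteIntegral_iff_ofReal (.of_forall fun z => by positivity)).1 h.2

/-- The Lipschitz bound leaves the kernel `|x - y| ^ (2 - d - 2σ)`, whose exponent exceeds `-d`
because `σ < 1`. The inner integral is then bounded uniformly in `x`. -/
theorem slobodeckijEnergy_lt_top_of_lipschitzOnWith {d : ℕ} [NeZero d] {σ : ℝ} (hσ : σ < 1)
    {Ω : Set (EuclideanSpace ℝ (Fin d))} {R : ℝ} (hΩ : Ω ⊆ Metric.ball 0 R)
    {g : EuclideanSpace ℝ (Fin d) → ℝ} {K : NNReal} (hg : LipschitzOnWith K g (Metric.ball 0 R)) :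
    slobodeckijEnergy σ Ω g < ⊤ := by
  set a : ℝ := 2 - (d + 2 * σ) with ha
  have hpt : ∀ x ∈ Metric.ball (0 : EuclideanSpace ℝ (Fin d)) R,
      ∀ y ∈ Metric.ball (0 : EuclideanSpace ℝ (Fin d)) R,
      |g x - g y| ^ 2 / ‖x - y‖ ^ ((d : ℝ) + 2 * σ) ≤ (K : ℝ) ^ 2 * ‖y - x‖ ^ a := by
    intro x hx y hy
    rcases eq_or_ne x y with rfl | hxy
    · simpa using by positivity
    have hpos : 0 < ‖x - y‖ := norm_pos_iff.2 (sub_ne_zero.2 hxy)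
    have h1 : |g x - g y| ≤ K * ‖x - y‖ := by
      simpa [Real.dist_eq, dist_eq_norm] using hg.dist_le_mul x hx y hy
    rw [norm_sub_rev y x, ha, Real.rpow_sub hpos, Real.rpow_two, ← mul_div_assoc, ← mul_pow]
    gcongr
  have hinner : ∀ x ∈ Metric.ball (0 : EuclideanSpace ℝ (Fin d)) R,
      ∫⁻ y in Metric.ball (0 : EuclideanSpace ℝ (Fin d)) R,
        ENNReal.ofReal (|g x - g y| ^ 2 / ‖x - y‖ ^ ((d : ℝ) + 2 * σ))
      ≤ ENNReal.ofReal ((K : ℝ) ^ 2) *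
        ∫⁻ z in Metric.ball (0 : EuclideanSpace ℝ (Fin d)) (2 * R), ENNReal.ofReal (‖z‖ ^ a) := by
    intro x hx
    calc _ ≤ ∫⁻ y in Metric.ball (0 : EuclideanSpace ℝ (Fin d)) R,
          ENNReal.ofReal ((K : ℝ) ^ 2) * ENNReal.ofReal (‖y - x‖ ^ a) := by
          refine setLIntegral_mono' measurableSet_ball fun y hy => ?_
          rw [← ENNReal.ofReal_mul (by positivity)]
          exact ENNReal.ofReal_le_ofReal (hpt x hx y hy)
      _ = ENNReal.ofReal ((K : ℝ) ^ 2) * ∫⁻ y in Metric.ball (0 : EuclideanSpace ℝ (Fin d)) R,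
          ENNReal.ofReal (‖y - x‖ ^ a) := lintegral_const_mul' _ _ ENNReal.ofReal_ne_top
      _ ≤ _ := by
        refine mul_le_mul' le_rfl ?_
        -- Translation by `x` centres the kernel; differences of points of the ball of radius `R`
        -- lie in the ball of radius `2R`.
        rw [← lintegral_indicator measurableSet_ball, ← lintegral_indicator measurableSet_ball,
          ← lintegral_sub_right_eq_self ((Metric.ball _ (2 * R)).indicator _) x]
        refine lintegral_mono fun y => ?_
        by_cases hy : y ∈ Metric.ball (0 : EuclideanSpace ℝ (Fin d)) R
        · have : y - x ∈ Metric.ball (0 : EuclideanSpace ℝ (Fin d)) (2 * R) := by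
            rw [mem_ball_zero_iff] at *
            linarith [norm_sub_le y x]
          simp [Set.indicator_of_mem hy, Set.indicator_of_mem this]
        · simp [Set.indicator_of_notMem hy]
  have hfin : ∫⁻ z in Metric.ball (0 : EuclideanSpace ℝ (Fin d)) (2 * R),
      ENNReal.ofReal (‖z‖ ^ a) < ⊤ :=
    lintegral_ball_norm_rpow_lt_top volume (by rw [finrank_euclideanSpace_fin]; linarith) _
  calc slobodeckijEnergy σ Ω g
      ≤ ∫⁻ x in Metric.ball (0 : EuclideanSpace ℝ (Fin d)) R,
          ∫⁻ y in Metric.ball (0 : EuclideanSpace ℝ (Fin d)) R,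
          ENNReal.ofReal (|g x - g y| ^ 2 / ‖x - y‖ ^ ((d : ℝ) + 2 * σ)) :=
        (lintegral_mono fun x => lintegral_mono_set hΩ).trans (lintegral_mono_set hΩ)
    _ ≤ ∫⁻ _ in Metric.ball (0 : EuclideanSpace ℝ (Fin d)) R, ENNReal.ofReal ((K : ℝ) ^ 2) *
        ∫⁻ z in Metric.ball (0 : EuclideanSpace ℝ (Fin d)) (2 * R), ENNReal.ofReal (‖z‖ ^ a) :=
        setLIntegral_mono' measurableSet_ball hinner
    _ < ⊤ := by
        rw [setLIntegral_const]
        exact ENNReal.mul_lt_top (ENNReal.mul_lt_top ENNReal.ofReal_lt_top hfin)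
          measure_ball_lt_top

theorem Continuous.memLp_restrict_of_subset_ball {E : Type*} [NormedAddCommGroup E]
    [NormedSpace ℝ E] [FiniteDimensional ℝ E] [MeasurableSpace E] [BorelSpace E] {μ : Measure E}
    [IsFiniteMeasureOnCompacts μ] {f : E → ℝ} (hf : Continuous f) {p : ENNReal} {Ω : Set E}
    {R : ℝ} (hΩ : Ω ⊆ Metric.ball 0 R) : MemLp f p (μ.restrict Ω) := by
  have hK := isCompact_closedBall (0 : E) R
  obtain ⟨C, hC⟩ := hK.exists_bound_of_continuousOn hf.continuousOn
  have : IsFiniteMeasure (μ.restrict (Metric.closedBall (0 : E) R)) :=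
    ⟨by rw [Measure.restrict_apply_univ]; exact hK.measure_lt_top⟩
  have h : MemLp f p (μ.restrict (Metric.closedBall (0 : E) R)) :=
    MemLp.of_bound hf.aestronglyMeasurable C
      ((ae_restrict_iff' Metric.isClosed_closedBall.measurableSet).2 (.of_forall hC))
  exact h.mono_measure (Measure.restrict_mono_set μ (hΩ.trans Metric.ball_subset_closedBall))

theorem ContDiff.memSobolevSlobodeckij {d : ℕ} [NeZero d] (s : ℝ)
    {Ω : Set (EuclideanSpace ℝ (Fin d))} {R : ℝ} (hΩ : Ω ⊆ Metric.ball 0 R)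
    {u : EuclideanSpace ℝ (Fin d) → ℝ} (hu : ContDiff ℝ (⊤ : ℕ∞) u) :
    MemSobolevSlobodeckij s Ω u := by
  have hd : ∀ {l : ℕ} (ι : Fin l → Fin d), ContDiff ℝ (⊤ : ℕ∞) (multiPartialDeriv l ι u) :=
    fun ι => contDiffOn_univ.1 (hu.contDiffOn.multiPartialDeriv isOpen_univ ι)
  refine ⟨⟨hu.continuous.memLp_restrict_of_subset_ball hΩ, fun j _ ι =>
    ⟨_, hu.isWeakPartialDeriv Ω ι, (hd ι).continuous.memLp_restrict_of_subset_ball hΩ⟩⟩,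
    fun _ ι => ⟨_, hu.isWeakPartialDeriv Ω ι,
      (hd ι).continuous.memLp_restrict_of_subset_ball hΩ, ?_⟩⟩
  -- The Lipschitz constant comes from the compact convex ball, since `Ω` need not be convex.
  obtain ⟨K, hK⟩ := ((hd ι).contDiffOn (s := Metric.closedBall 0 R)).exists_lipschitzOnWith
    (by simp) (convex_closedBall _ _) (isCompact_closedBall _ _)
  exact slobodeckijEnergy_lt_top_of_lipschitzOnWith (by linarith [Nat.lt_floor_add_one s]) hΩ
    (hK.mono Metric.ball_subset_closedBall)

/-! ### The Bessel function as a power times an entire function -/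

/-- The coefficients of the entire function `t ↦ t ^ (-ν/2) J_ν (μ t ^ (1/2))`. -/
noncomputable def besselCoeff (ν μ : ℝ) (j : ℕ) : ℝ :=
  (-1) ^ j / ((Nat.factorial j : ℝ) * Real.Gamma (ν + (j : ℝ) + 1)) * (μ / 2) ^ (2 * (j : ℝ) + ν)

theorem besselCoeff_ne_zero {ν μ : ℝ} (hν : 0 ≤ ν) (hμ : 0 < μ) (j : ℕ) :
    besselCoeff ν μ j ≠ 0 := by
  have h1 : 0 < Real.Gamma (ν + (j : ℝ) + 1) := Real.Gamma_pos_of_pos (by positivity)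
  have h2 : 0 < (μ / 2) ^ (2 * (j : ℝ) + ν) := by positivity
  have h3 : (0 : ℝ) < Nat.factorial j := by positivity
  unfold besselCoeff
  have h4 : ((-1 : ℝ)) ^ j ≠ 0 := pow_ne_zero _ (by norm_num)
  positivity

theorem besselCoeff_succ {ν μ : ℝ} (hν : 0 ≤ ν) (hμ : 0 < μ) (j : ℕ) :
    besselCoeff ν μ (j + 1)
      = -((μ / 2) ^ 2 / (((j : ℝ) + 1) * (ν + j + 1))) * besselCoeff ν μ j := by
  have h0 : 0 < ν + (j : ℝ) + 1 := by positivity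
  have h1 : 0 < Real.Gamma (ν + (j : ℝ) + 1) := Real.Gamma_pos_of_pos h0
  have h3 : (0 : ℝ) < Nat.factorial j := by positivity
  unfold besselCoeff
  rw [show 2 * ((j + 1 : ℕ) : ℝ) + ν = 2 + (2 * (j : ℝ) + ν) by push_cast; ring,
    Real.rpow_add (by positivity), Real.rpow_two,
    show ν + ((j + 1 : ℕ) : ℝ) + 1 = (ν + (j : ℝ) + 1) + 1 by push_cast; ring,
    Real.Gamma_add_one h0.ne', Nat.factorial_succ, pow_succ]
  push_cast
  field_simp

theorem tendsto_norm_besselCoeff_ratio {ν μ : ℝ} (hν : 0 ≤ ν) (hμ : 0 < μ) :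
    Filter.Tendsto (fun j => ‖besselCoeff ν μ j.succ‖ / ‖besselCoeff ν μ j‖) Filter.atTop
      (𝓝 0) := by
  have h : ∀ j : ℕ, ‖besselCoeff ν μ j.succ‖ / ‖besselCoeff ν μ j‖
      ≤ (μ / 2) ^ 2 * (1 / ((j : ℝ) + 1)) := fun j => by
    rw [Nat.succ_eq_add_one, besselCoeff_succ hν hμ, norm_mul,
      mul_div_cancel_right₀ _ (norm_ne_zero_iff.2 (besselCoeff_ne_zero hν hμ j)), norm_neg,
      Real.norm_of_nonneg (by positivity), mul_one_div]
    have : (0 : ℝ) ≤ j := by positivity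
    gcongr
    nlinarith
  refine squeeze_zero (fun j => by positivity) h ?_
  simpa only [mul_zero] using
    (tendsto_one_div_add_atTop_nhds_zero_nat (𝕜 := ℝ)).const_mul ((μ / 2) ^ 2)

/-- Ratio test: consecutive coefficients have ratio tending to `0`, so the radius of convergence is
infinite. -/
theorem contDiff_ofScalarsSum_besselCoeff {ν μ : ℝ} (hν : 0 ≤ ν) (hμ : 0 < μ) :
    ContDiff ℝ (⊤ : ℕ∞) (FormalMultilinearSeries.ofScalarsSum (E := ℝ) (besselCoeff ν μ)) := by
  have hr : (FormalMultilinearSeries.ofScalars ℝ (besselCoeff ν μ)).radius = ⊤ :=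
    FormalMultilinearSeries.ofScalars_radius_eq_top_of_tendsto ℝ _
      (.of_forall (besselCoeff_ne_zero hν hμ)) (tendsto_norm_besselCoeff_ratio hν hμ)
  have h := (FormalMultilinearSeries.ofScalars ℝ (besselCoeff ν μ)).hasFPowerSeriesOnBall
    (by rw [hr]; exact ENNReal.coe_lt_top)
  rw [hr] at h
  have h2 := h.analyticOnNhd
  rw [Metric.eball_top] at h2
  exact contDiffOn_univ.1 (h2.contDiffOn uniqueDiffOn_univ)

/-- Termwise `r ^ (2j + ν) = r ^ (2j) r ^ ν`. This also holds at `r = 0` because both exponents are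
nonnegative, so the vertex needs no separate treatment. -/
theorem besselJ_mul {ν μ r : ℝ} (hν : 0 ≤ ν) (hμ : 0 < μ) (hr : 0 ≤ r) :
    besselJ ν (μ * r)
      = r ^ ν * FormalMultilinearSeries.ofScalarsSum (E := ℝ) (besselCoeff ν μ) (r ^ 2) := by
  rw [FormalMultilinearSeries.ofScalarsSum_eq_tsum, besselJ, ← tsum_mul_left]
  refine tsum_congr fun j => ?_
  rw [besselCoeff, mul_div_right_comm, Real.mul_rpow (by positivity) hr,
    Real.rpow_add_of_nonneg hr (by positivity) hν, smul_eq_mul,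
    show 2 * (j : ℝ) = ((2 * j : ℕ) : ℝ) by push_cast; ring, Real.rpow_natCast, pow_mul r]
  ring

/-- The scale in the radial variable is positive. This is all that regularity depends on: the
results below hold for `J_ν(μ r) cos(ν φ)` with an arbitrary `μ > 0`. -/
theorem besselZero_pos (ν : ℝ) (m : ℕ) : 0 < besselZero ν m := by
  unfold besselZero
  split_ifs with h
  · exact h.choose_spec.1
  · exact one_pos

/-! ### Complex coordinates in the plane -/

/-- The isometry `(x, y) ↦ x + iy` from the Euclidean plane to `ℂ`. -/
noncomputable def toComplex : EuclideanSpace ℝ (Fin 2) ≃ₗᵢ[ℝ] ℂ :=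
  Complex.orthonormalBasisOneI.repr.symm

theorem toComplex_apply (x : EuclideanSpace ℝ (Fin 2)) : toComplex x = ⟨x 0, x 1⟩ := by
  have h := Complex.orthonormalBasisOneI.sum_repr_symm x
  rw [toComplex, ← h]
  apply Complex.ext <;> simp [Fin.sum_univ_two]

theorem polarAngle_eq_arg {x : EuclideanSpace ℝ (Fin 2)} (h : 0 ≤ (toComplex x).arg) :
    polarAngle x = (toComplex x).arg := by
  rw [polarAngle, ← toComplex_apply, toIcoMod_eq_self Real.two_pi_pos]
  exact ⟨h, by linarith [Complex.arg_le_pi (toComplex x), Real.pi_pos]⟩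

/-- The two angles differ by a multiple of `2π`, which an integer frequency does not see. -/
theorem cos_nat_mul_polarAngle (n : ℕ) (x : EuclideanSpace ℝ (Fin 2)) :
    Real.cos (n * polarAngle x) = Real.cos (n * (toComplex x).arg) := by
  rw [polarAngle, ← toComplex_apply, toIcoMod, zsmul_eq_mul, mul_sub,
    show (n : ℝ) * ((toIcoDiv Real.two_pi_pos 0 (toComplex x).arg : ℤ) * (2 * Real.pi))
      = ((n * toIcoDiv Real.two_pi_pos 0 (toComplex x).arg : ℤ) : ℝ) * (2 * Real.pi) by
        push_cast; ring, Real.cos_sub_int_mul_two_pi]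

theorem circularSector_subset_ball (ω : ℝ) : circularSector ω ⊆ Metric.ball 0 1 := by
  rintro x ⟨r, φ, hr, hr1, -, -, rfl⟩
  rwa [mem_ball_zero_iff, norm_polar hr.le]

/-- For an integer order, `J_n(μ r) cos(n φ)` is the restriction of a smooth function. -/
theorem contDiff_besselJ_mul_cos (n : ℕ) {μ : ℝ} (hμ : 0 < μ) :
    ContDiff ℝ (⊤ : ℕ∞) fun x : EuclideanSpace ℝ (Fin 2) =>
      besselJ n (μ * ‖x‖) * Real.cos (n * polarAngle x) := by
  have h : (fun x : EuclideanSpace ℝ (Fin 2) =>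
      besselJ n (μ * ‖x‖) * Real.cos (n * polarAngle x)) = fun x => (toComplex x ^ n).re *
        FormalMultilinearSeries.ofScalarsSum (E := ℝ) (besselCoeff n μ) (‖x‖ ^ 2) := by
    funext x
    have := Complex.cpow_ofReal_re (toComplex x) n
    rw [Complex.ofReal_natCast, Complex.cpow_natCast, LinearIsometryEquiv.norm_map] at this
    rw [this, besselJ_mul n.cast_nonneg hμ (norm_nonneg x), cos_nat_mul_polarAngle,
      mul_comm (n : ℝ)]
    ring
  rw [h]
  exact (Complex.reCLM.contDiff.comp (toComplex.contDiff.pow n)).mul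
    ((contDiff_ofScalarsSum_besselCoeff n.cast_nonneg hμ).comp (contDiff_norm_sq ℝ))

/-! ### Derivatives of `Re (z ^ ν Q(z))` -/

/-- Product rule with `∂₁ z = 1`. Pulling out `z ^ (ν - 1)` keeps the form `Re (z ^ b Q')`, so the
computation can be iterated. -/
theorem fderiv_re_cpow_mul_apply_single {ν : ℝ} {Q : EuclideanSpace ℝ (Fin 2) → ℂ}
    {x : EuclideanSpace ℝ (Fin 2)} (hx : toComplex x ∈ Complex.slitPlane)
    (hQ : DifferentiableAt ℝ Q x) :
    fderiv ℝ (fun y => (toComplex y ^ (ν : ℂ) * Q y).re) x (EuclideanSpace.single 0 1)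
      = (toComplex x ^ ((ν - 1 : ℝ) : ℂ) * (ν * Q x + toComplex x *
        fderiv ℝ Q x (EuclideanSpace.single 0 1))).re := by
  have hz : HasFDerivAt (fun y => toComplex y)
      (toComplex.toContinuousLinearEquiv : EuclideanSpace ℝ (Fin 2) →L[ℝ] ℂ) x :=
    toComplex.toContinuousLinearEquiv.hasFDerivAt
  have hp : HasDerivAt (fun z : ℂ => z ^ (ν : ℂ)) (ν * toComplex x ^ ((ν : ℂ) - 1))
      (toComplex x) := by
    simpa using (hasDerivAt_id (toComplex x)).cpow_const (c := (ν : ℂ)) hx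
  have h1 := hp.comp_hasFDerivAt_of_eq x hz rfl
  have h2 := Complex.reCLM.hasFDerivAt.comp x (h1.mul hQ.hasFDerivAt)
  have h3 : toComplex (EuclideanSpace.single 0 1) = 1 := by
    rw [toComplex_apply]; apply Complex.ext <;> simp
  have h4 : toComplex x ^ (ν : ℂ) = toComplex x ^ ((ν : ℂ) - 1) * toComplex x := by
    have := Complex.slitPlane_ne_zero hx
    rw [Complex.cpow_sub _ _ this, Complex.cpow_one, div_mul_cancel₀ _ this]
  have h5 := congrArg (fun L : EuclideanSpace ℝ (Fin 2) →L[ℝ] ℝ => L (EuclideanSpace.single 0 1))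
    h2.fderiv
  refine Eq.trans h5 ?_
  simp only [ContinuousLinearMap.comp_apply, Complex.reCLM_apply]
  congr 1
  simp [h3, h4]
  ring

theorem contDiffOn_re_cpow_mul {K : Set (EuclideanSpace ℝ (Fin 2))}
    (hK : ∀ x ∈ K, toComplex x ∈ Complex.slitPlane) (ν : ℂ) {Q : EuclideanSpace ℝ (Fin 2) → ℂ}
    (hQ : ContDiff ℝ (⊤ : ℕ∞) Q) :
    ContDiffOn ℝ (⊤ : ℕ∞) (fun x => (toComplex x ^ ν * Q x).re) K := by
  intro x hx
  have h1 : ContDiffAt ℂ (⊤ : ℕ∞) (fun z : ℂ => z ^ ν) (toComplex x) :=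
    (analyticAt_id.cpow analyticAt_const (hK x hx)).contDiffAt
  have h2 : ContDiffAt ℝ (⊤ : ℕ∞) (fun y => toComplex y ^ ν) x :=
    (h1.restrict_scalars ℝ).comp x toComplex.contDiff.contDiffAt
  exact (Complex.reCLM.contDiff.contDiffAt.comp x (h2.mul hQ.contDiffAt)).contDiffWithinAt

/-- Differentiating `Re (z ^ ν Q)` with respect to the first coordinate `l` times gives a function
of the same form, whose leading coefficient does not vanish unless `ν ∈ {0, …, l - 1}`. -/
theorem exists_multiPartialDeriv_eqOn_re_cpow_mul {K : Set (EuclideanSpace ℝ (Fin 2))}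
    (hKo : IsOpen K) (hK : ∀ x ∈ K, toComplex x ∈ Complex.slitPlane) (l : ℕ) {ν : ℝ}
    (hν : ∀ i < l, ν ≠ i) {f : EuclideanSpace ℝ (Fin 2) → ℝ} {Q : EuclideanSpace ℝ (Fin 2) → ℂ}
    (hQ : ContDiff ℝ (⊤ : ℕ∞) Q) {q : ℝ} (hq : q ≠ 0) (hQ0 : Q 0 = q)
    (hf : Set.EqOn f (fun x => (toComplex x ^ (ν : ℂ) * Q x).re) K) :
    ∃ (P : EuclideanSpace ℝ (Fin 2) → ℂ) (p : ℝ), Continuous P ∧ p ≠ 0 ∧ P 0 = p ∧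
      Set.EqOn (multiPartialDeriv l (fun _ => 0) f)
        (fun x => (toComplex x ^ ((ν - l : ℝ) : ℂ) * P x).re) K := by
  induction l generalizing ν f Q q with
  | zero => exact ⟨Q, q, hQ.continuous, hq, hQ0, by simpa only [multiPartialDeriv, Nat.cast_zero, sub_zero] using hf⟩
  | succ l ih =>
    -- At the origin the factor `z` removes the derivative of `Q`, so the leading coefficient
    -- becomes `ν q`.
    obtain ⟨P, p, hP, hp, hP0, hE⟩ := ih (ν := ν - 1)
      (f := fun x => fderiv ℝ f x (EuclideanSpace.single 0 1))
      (Q := fun x => ν * Q x + toComplex x * fderiv ℝ Q x (EuclideanSpace.single 0 1))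
      (q := ν * q)
      (fun i hi h => hν (i + 1) (by omega) (by push_cast; linarith))
      ((contDiff_const.mul hQ).add (toComplex.contDiff.mul
        ((hQ.fderiv_right (m := ((⊤ : ℕ∞) : WithTop ℕ∞)) le_rfl).clm_apply contDiff_const)))
      (mul_ne_zero (by simpa using hν 0 l.succ_pos) hq) (by simp [hQ0])
      (fun x hx => by
        have h1 : f =ᶠ[𝓝 x] fun x => (toComplex x ^ (ν : ℂ) * Q x).re :=
          Filter.eventuallyEq_of_mem (hKo.mem_nhds hx) hf
        simp only [h1.fderiv_eq]
        exact fderiv_re_cpow_mul_apply_single (hK x hx) (hQ.differentiable (by simp) x))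
    refine ⟨P, p, hP, hp, hP0, fun x hx => ?_⟩
    have h := hE hx
    rw [show ν - 1 - (l : ℝ) = ν - ((l + 1 : ℕ) : ℝ) by push_cast; ring] at h
    exact h

/-- `Re (z ^ a P)` is comparable with `|z| ^ a` near the origin in a cone on which
`Re (z ^ a)` is bounded below by `|z| ^ a / 2`. -/
theorem exists_norm_rpow_bounds_re_cpow_mul (a : ℝ) {P : EuclideanSpace ℝ (Fin 2) → ℂ} {p : ℝ}
    (hP : Continuous P) (hp : p ≠ 0) (hP0 : P 0 = p) :
    ∃ r > 0, ∃ c > 0, ∃ C > 0, ∀ x : EuclideanSpace ℝ (Fin 2), ‖x‖ < r →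
      |(toComplex x).arg * a| ≤ 1 →
        c * ‖x‖ ^ a ≤ |(toComplex x ^ (a : ℂ) * P x).re| ∧
        |(toComplex x ^ (a : ℂ) * P x).re| ≤ C * ‖x‖ ^ a := by
  have hp' : 0 < |p| := abs_pos.2 hp
  obtain ⟨r, hr, hrP⟩ := Metric.continuousAt_iff.1 hP.continuousAt (|p| / 4) (by positivity)
  -- The main term `p Re (z ^ a)` has size between `|p|/2` and `|p|` times `|x| ^ a`, and replacing
  -- `P x` by `p` costs at most `|p|/4` times `|x| ^ a`.
  refine ⟨r, hr, |p| / 4, by positivity, 2 * |p|, by positivity, fun x hx harg => ?_⟩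
  have hd : ‖P x - p‖ < |p| / 4 := by
    have := hrP (x := x) (by rwa [dist_zero_right])
    rwa [hP0, dist_eq_norm] at this
  have hn : ‖toComplex x ^ (a : ℂ)‖ ≤ ‖x‖ ^ a := by
    rw [Complex.norm_cpow_real, toComplex.norm_map]
  have hxa : 0 ≤ ‖x‖ ^ a := by positivity
  have hre : (toComplex x ^ (a : ℂ) * P x).re
      = p * (‖x‖ ^ a * Real.cos ((toComplex x).arg * a))
        + (toComplex x ^ (a : ℂ) * (P x - p)).re := by
    rw [← (toComplex.norm_map x), ← Complex.cpow_ofReal_re, mul_sub, Complex.sub_re,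
      Complex.re_mul_ofReal]
    ring
  have herr : |(toComplex x ^ (a : ℂ) * (P x - p)).re| ≤ ‖x‖ ^ a * (|p| / 4) := by
    refine (Complex.abs_re_le_norm _).trans ?_
    rw [norm_mul]
    gcongr
  have hcos : 1 / 2 ≤ Real.cos ((toComplex x).arg * a) := by
    have h1 := Real.one_sub_sq_div_two_le_cos (x := (toComplex x).arg * a)
    have h2 : ((toComplex x).arg * a) ^ 2 ≤ 1 := (sq_le_one_iff_abs_le_one _).2 harg
    linarith
  have hmain : |p * (‖x‖ ^ a * Real.cos ((toComplex x).arg * a))|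
      = |p| * ‖x‖ ^ a * Real.cos ((toComplex x).arg * a) := by
    rw [abs_mul, abs_of_nonneg (mul_nonneg hxa (by linarith)), mul_assoc]
  have hb : 0 ≤ |p| * ‖x‖ ^ a := by positivity
  rw [hre]
  constructor
  · have := abs_sub_abs_le_abs_add (p * (‖x‖ ^ a * Real.cos ((toComplex x).arg * a)))
      (toComplex x ^ (a : ℂ) * (P x - p)).re
    nlinarith
  · have := abs_add_le (p * (‖x‖ ^ a * Real.cos ((toComplex x).arg * a)))
      (toComplex x ^ (a : ℂ) * (P x - p)).re
    nlinarith [Real.cos_le_one ((toComplex x).arg * a)]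

/-! ### Divergent integrals over plane cones -/

/-- The open cone of points whose polar angle lies between `0` and `arctan δ`. -/
def planeCone (δ : ℝ) : Set (EuclideanSpace ℝ (Fin 2)) :=
  {x | 0 < x 1 ∧ x 1 < δ * x 0}

/-- The part of `planeCone δ` at distance between `s` and `t` from the origin. -/
def planeConeAnnulus (δ s t : ℝ) : Set (EuclideanSpace ℝ (Fin 2)) :=
  planeCone δ ∩ {x | s < ‖x‖ ∧ ‖x‖ < t}

theorem isOpen_planeCone (δ : ℝ) : IsOpen (planeCone δ) :=
  (isOpen_lt (f := fun _ : EuclideanSpace ℝ (Fin 2) => (0 : ℝ)) (g := fun x => x 1)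
    (by fun_prop) (by fun_prop)).inter
    (isOpen_lt (f := fun x : EuclideanSpace ℝ (Fin 2) => x 1) (g := fun x => δ * x 0)
      (by fun_prop) (by fun_prop))

theorem isOpen_planeConeAnnulus (δ s t : ℝ) : IsOpen (planeConeAnnulus δ s t) :=
  (isOpen_planeCone δ).inter
    ((isOpen_lt continuous_const continuous_norm).inter
      (isOpen_lt continuous_norm continuous_const))

theorem smul_mem_planeCone {δ c : ℝ} (hc : 0 < c) {x : EuclideanSpace ℝ (Fin 2)}
    (hx : x ∈ planeCone δ) : c • x ∈ planeCone δ := by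
  obtain ⟨h1, h2⟩ := hx
  refine ⟨by simpa using mul_pos hc h1, ?_⟩
  simp only [PiLp.smul_apply, smul_eq_mul]
  nlinarith

theorem smul_mem_planeConeAnnulus {δ s t c : ℝ} (hc : 0 < c) {x : EuclideanSpace ℝ (Fin 2)}
    (hx : x ∈ planeConeAnnulus δ s t) : c • x ∈ planeConeAnnulus δ (c * s) (c * t) := by
  obtain ⟨h1, h2, h3⟩ := hx
  refine ⟨smul_mem_planeCone hc h1, ?_⟩
  simp only [Set.mem_ofPred_eq, norm_smul, Real.norm_of_nonneg hc.le]
  exact ⟨by gcongr, by gcongr⟩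

open scoped Pointwise in
theorem volume_planeConeAnnulus_mul (δ s t : ℝ) {c : ℝ} (hc : 0 < c) :
    volume (planeConeAnnulus δ (c * s) (c * t))
      = ENNReal.ofReal (c ^ 2) * volume (planeConeAnnulus δ s t) := by
  have h : planeConeAnnulus δ (c * s) (c * t) = c • planeConeAnnulus δ s t := by
    ext x
    rw [Set.mem_smul_set_iff_inv_smul_mem₀ hc.ne']
    constructor
    · intro hx
      have := smul_mem_planeConeAnnulus (inv_pos.2 hc) hx
      rwa [inv_mul_cancel_left₀ hc.ne', inv_mul_cancel_left₀ hc.ne'] at this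
    · intro hx
      have := smul_mem_planeConeAnnulus hc hx
      rwa [smul_inv_smul₀ hc.ne'] at this
  rw [h, Measure.addHaar_smul_of_nonneg _ hc.le, finrank_euclideanSpace_fin]

theorem volume_planeConeAnnulus_pos {δ s t : ℝ} (hδ : 0 < δ) (hs : 0 ≤ s) (hst : s < t) :
    0 < volume (planeConeAnnulus δ s t) := by
  refine (isOpen_planeConeAnnulus δ s t).measure_pos volume ?_
  have hx : (!₂[1, δ / 2] : EuclideanSpace ℝ (Fin 2)) ∈ planeCone δ := by
    constructor <;> simp [hδ]
  have hn : 0 < ‖(!₂[1, δ / 2] : EuclideanSpace ℝ (Fin 2))‖ := by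
    refine norm_pos_iff.2 fun h => ?_
    have := congrArg (fun y : EuclideanSpace ℝ (Fin 2) => y 0) h
    simp at this
  refine ⟨((s + t) / 2 / ‖(!₂[1, δ / 2] : EuclideanSpace ℝ (Fin 2))‖) • !₂[1, δ / 2],
    smul_mem_planeCone (by have : 0 < s + t := by linarith
                           positivity) hx, ?_⟩
  rw [Set.mem_ofPred_eq, norm_smul, Real.norm_of_nonneg (div_nonneg (by linarith) hn.le),
    div_mul_cancel₀ _ hn.ne']
  constructor <;> linarith

theorem volume_planeConeAnnulus_lt_top (δ s t : ℝ) : volume (planeConeAnnulus δ s t) < ⊤ :=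
  (measure_mono fun _ hx => mem_ball_zero_iff.2 hx.2.2).trans_lt
    (measure_ball_lt_top (x := (0 : EuclideanSpace ℝ (Fin 2))) (r := t))

/-- The weight `|x| ^ (-2)` is scale invariant in the plane: shrinking an annulus by `2 ^ (-j)`
divides its area by `4 ^ j` and multiplies the weight by `4 ^ j`. Infinitely many disjoint dyadic
annuli thus share one positive lower bound. -/
theorem lintegral_planeCone_inter_ball_norm_rpow_neg_two {δ r : ℝ} (hδ : 0 < δ) (hr : 0 < r) :
    ∫⁻ x in planeCone δ ∩ Metric.ball 0 r, ENNReal.ofReal (‖x‖ ^ (-2 : ℝ)) = ⊤ := by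
  set A : ℕ → Set (EuclideanSpace ℝ (Fin 2)) := fun j =>
    planeConeAnnulus δ ((1 / 2) ^ j * (r / 2)) ((1 / 2) ^ j * r) with hA
  have hdisj : Pairwise (Function.onFun Disjoint A) := by
    have key : ∀ i j, i < j → Disjoint (A i) (A j) := fun i j hij => by
      refine Set.disjoint_left.2 fun x hxi hxj => ?_
      have h1 := hxi.2.1
      have h2 := hxj.2.2
      have h3 : ((1 : ℝ) / 2) ^ j ≤ (1 / 2) ^ (i + 1) :=
        pow_le_pow_of_le_one (by norm_num) (by norm_num) hij
      rw [pow_succ] at h3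
      nlinarith
    intro i j hij
    rcases lt_or_gt_of_ne hij with h | h
    · exact key i j h
    · exact (key j i h).symm
  have hsub : ⋃ j, A j ⊆ planeCone δ ∩ Metric.ball 0 r := by
    refine Set.iUnion_subset fun j x hx => ⟨hx.1, mem_ball_zero_iff.2 (hx.2.2.trans_le ?_)⟩
    exact mul_le_of_le_one_left hr.le (pow_le_one₀ (by norm_num) (by norm_num))
  set V := volume (planeConeAnnulus δ (r / 2) r) with hV
  have hVpos : 0 < V := volume_planeConeAnnulus_pos hδ (by positivity) (by linarith)
  have hlow : ∀ j, ENNReal.ofReal (r ^ (-2 : ℝ)) * V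
      ≤ ∫⁻ x in A j, ENNReal.ofReal (‖x‖ ^ (-2 : ℝ)) := fun j => by
    have hc : (0 : ℝ) < (1 / 2) ^ j := by positivity
    calc ENNReal.ofReal (r ^ (-2 : ℝ)) * V
        = ENNReal.ofReal (((1 / 2) ^ j * r) ^ (-2 : ℝ)) * volume (A j) := by
          rw [hA, volume_planeConeAnnulus_mul _ _ _ hc, ← mul_assoc,
            ← ENNReal.ofReal_mul (by positivity), Real.mul_rpow hc.le hr.le, Real.rpow_neg hc.le,
            Real.rpow_two]
          congr 2
          field_simp
      _ = ∫⁻ _ in A j, ENNReal.ofReal (((1 / 2) ^ j * r) ^ (-2 : ℝ)) :=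
          (setLIntegral_const _ _).symm
      _ ≤ _ := setLIntegral_mono' (isOpen_planeConeAnnulus _ _ _).measurableSet fun x hx =>
          ENNReal.ofReal_le_ofReal (Real.rpow_le_rpow_of_nonpos
            (lt_of_le_of_lt (by positivity) hx.2.1) hx.2.2.le (by norm_num))
  refine top_le_iff.1 ?_
  calc (⊤ : ENNReal) = ∑' _ : ℕ, ENNReal.ofReal (r ^ (-2 : ℝ)) * V :=
        (ENNReal.tsum_const_eq_top_of_ne_zero (mul_ne_zero
          (ENNReal.ofReal_pos.2 (by positivity)).ne' hVpos.ne')).symm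
    _ ≤ ∑' j, ∫⁻ x in A j, ENNReal.ofReal (‖x‖ ^ (-2 : ℝ)) := ENNReal.tsum_le_tsum hlow
    _ = ∫⁻ x in ⋃ j, A j, ENNReal.ofReal (‖x‖ ^ (-2 : ℝ)) :=
        (lintegral_iUnion (fun j => (isOpen_planeConeAnnulus _ _ _).measurableSet) hdisj _).symm
    _ ≤ _ := lintegral_mono_set hsub

theorem norm_pos_of_mem_planeCone {δ : ℝ} {x : EuclideanSpace ℝ (Fin 2)} (hx : x ∈ planeCone δ) :
    0 < ‖x‖ :=
  norm_pos_iff.2 fun h => by simpa [h] using hx.1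

/-- For `|x| ≤ 1` and `a ≤ -1`, `|x| ^ (2a)` dominates the non-integrable `|x| ^ (-2)`. -/
theorem lintegral_sq_eq_top_of_norm_rpow_le {δ r c a : ℝ} (hδ : 0 < δ) (hr : 0 < r)
    (hr1 : r ≤ 1) (hc : 0 < c) (ha : a ≤ -1) {g : EuclideanSpace ℝ (Fin 2) → ℝ}
    (hg : ∀ x ∈ planeCone δ ∩ Metric.ball 0 r, c * ‖x‖ ^ a ≤ |g x|) :
    ∫⁻ x in planeCone δ ∩ Metric.ball 0 r, ENNReal.ofReal (g x ^ 2) = ⊤ := by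
  have hm : MeasurableSet (planeCone δ ∩ Metric.ball 0 r) :=
    ((isOpen_planeCone δ).inter Metric.isOpen_ball).measurableSet
  refine top_le_iff.1 ?_
  calc (⊤ : ENNReal) = ∫⁻ x in planeCone δ ∩ Metric.ball 0 r,
        ENNReal.ofReal (c ^ 2) * ENNReal.ofReal (‖x‖ ^ (-2 : ℝ)) := by
        rw [lintegral_const_mul' _ _ ENNReal.ofReal_ne_top,
          lintegral_planeCone_inter_ball_norm_rpow_neg_two hδ hr,
          ENNReal.mul_top (ENNReal.ofReal_pos.2 (by positivity)).ne']
    _ ≤ _ := setLIntegral_mono' hm fun x hx => by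
        have hx0 := norm_pos_of_mem_planeCone hx.1
        have hx1 : ‖x‖ ≤ 1 := (mem_ball_zero_iff.1 hx.2).le.trans hr1
        rw [← ENNReal.ofReal_mul (by positivity)]
        refine ENNReal.ofReal_le_ofReal ?_
        calc c ^ 2 * ‖x‖ ^ (-2 : ℝ) ≤ c ^ 2 * ‖x‖ ^ (a * 2) := by
              gcongr 1
              exact Real.rpow_le_rpow_of_exponent_ge hx0 hx1 (by linarith)
          _ = (c * ‖x‖ ^ a) ^ 2 := by
              rw [mul_pow, Real.rpow_mul hx0.le, Real.rpow_two]
          _ ≤ |g x| ^ 2 := by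
              have := hg x hx
              gcongr
          _ = g x ^ 2 := sq_abs _

/-- A function comparable with `|x| ^ a`, `a < 0`, near the vertex of a plane cone has infinite
Slobodeckij energy of every order `σ ≥ a + 1`. -/
theorem slobodeckijEnergy_planeCone_eq_top {δ r c C a σ : ℝ} (hδ : 0 < δ) (hr : 0 < r)
    (hr1 : r ≤ 1) (hc : 0 < c) (hC : 0 < C) (ha : a < 0) (hσ0 : 0 < σ) (hσ : a + 1 ≤ σ)
    {g : EuclideanSpace ℝ (Fin 2) → ℝ}
    (hg : ∀ x ∈ planeCone δ ∩ Metric.ball 0 r, c * ‖x‖ ^ a ≤ |g x| ∧ |g x| ≤ C * ‖x‖ ^ a) :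
    slobodeckijEnergy σ (planeCone δ ∩ Metric.ball 0 r) g = ⊤ := by
  -- Since `a < 0`, a large `M` makes `|g y|` at most half the lower bound for `|g x|` whenever `|y|
  -- > M|x|`.
  obtain ⟨M, hM1, hM⟩ : ∃ M : ℝ, 1 < M ∧ C * M ^ a ≤ c / 2 := by
    have h1 : Filter.Tendsto (fun M : ℝ => C * M ^ a) Filter.atTop (𝓝 0) := by
      have := (tendsto_rpow_neg_atTop (y := -a) (by linarith)).const_mul C
      simpa using this
    have h2 := (h1.eventually_le_const (by positivity : (0 : ℝ) < c / 2)).and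
      (Filter.eventually_gt_atTop 1)
    obtain ⟨M, h3, h4⟩ := h2.exists
    exact ⟨M, h4, h3⟩
  have hM0 : 0 < M := by linarith
  -- For `|x| < r'` the annulus `M|x| < |y| < 2M|x|` stays in the ball of radius `r`.
  set r' : ℝ := r / (2 * M) with hr'
  have hr'0 : 0 < r' := by positivity
  have hr'r : r' ≤ r := div_le_self hr.le (by linarith)
  set V := volume (planeConeAnnulus δ M (2 * M)) with hV
  have hVpos : 0 < V := volume_planeConeAnnulus_pos hδ hM0.le (by linarith)
  -- The factor `3M` bounds `|x - y| / |x|`, as `|x| + 2M|x| ≤ 3M|x|`.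
  set k : ℝ := (c / 2) ^ 2 / (3 * M) ^ ((2 : ℝ) + 2 * σ) with hk
  have hkpos : 0 < k := by positivity
  have hpt : ∀ x ∈ planeCone δ ∩ Metric.ball 0 r',
      ∀ y ∈ planeConeAnnulus δ (‖x‖ * M) (‖x‖ * (2 * M)),
      k * ‖x‖ ^ (-4 : ℝ) ≤ |g x - g y| ^ 2 / ‖x - y‖ ^ (((2 : ℕ) : ℝ) + 2 * σ) := by
    intro x hx y hy
    have hx0 := norm_pos_of_mem_planeCone hx.1
    have hxr : ‖x‖ < r' := mem_ball_zero_iff.1 hx.2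
    have hyr : ‖y‖ < r := by
      refine hy.2.2.trans ?_
      rwa [← lt_div_iff₀ (by positivity)]
    have h1 := (hg x ⟨hx.1, mem_ball_zero_iff.2 (hxr.trans_le hr'r)⟩).1
    have h2 := (hg y ⟨hy.1, mem_ball_zero_iff.2 hyr⟩).2
    have h3 : ‖y‖ ^ a ≤ ‖x‖ ^ a * M ^ a := by
      rw [← Real.mul_rpow hx0.le hM0.le]
      exact Real.rpow_le_rpow_of_nonpos (by positivity) hy.2.1.le ha.le
    have hxa : 0 < ‖x‖ ^ a := by positivity
    have h4 : c / 2 * ‖x‖ ^ a ≤ |g x - g y| := by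
      have h5 : |g y| ≤ c / 2 * ‖x‖ ^ a := by
        calc |g y| ≤ C * (‖x‖ ^ a * M ^ a) := h2.trans (by gcongr)
          _ = (C * M ^ a) * ‖x‖ ^ a := by ring
          _ ≤ _ := by gcongr
      have := abs_sub_abs_le_abs_sub (g x) (g y)
      linarith
    have hyx : ‖x‖ < ‖y‖ := lt_trans (by nlinarith) hy.2.1
    have hxy0 : 0 < ‖x - y‖ := by
      rw [norm_sub_rev]
      exact lt_of_lt_of_le (sub_pos.2 hyx) (norm_sub_norm_le y x)
    have hxy : ‖x - y‖ ≤ 3 * M * ‖x‖ := by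
      have := norm_sub_le x y
      have := hy.2.2
      nlinarith
    have hx1 : ‖x‖ ≤ 1 := hxr.le.trans (hr'r.trans hr1)
    -- The hypothesis `a + 1 ≤ σ` says exactly that `2a - 2 - 2σ ≤ -4`.
    calc k * ‖x‖ ^ (-4 : ℝ) ≤ k * ‖x‖ ^ (a * 2 - (2 + 2 * σ)) := by
          gcongr 1
          exact Real.rpow_le_rpow_of_exponent_ge hx0 hx1 (by linarith)
      _ = (c / 2 * ‖x‖ ^ a) ^ 2 / (3 * M * ‖x‖) ^ (2 + 2 * σ) := by
          rw [hk, Real.rpow_sub hx0, Real.rpow_mul hx0.le, Real.rpow_two,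
            Real.mul_rpow (by positivity) hx0.le, mul_pow]
          field_simp
      _ ≤ |g x - g y| ^ 2 / ‖x - y‖ ^ (((2 : ℕ) : ℝ) + 2 * σ) := by
          push_cast
          gcongr
  -- The annulus of points `y` has area `|x|² V`, which turns `|x| ^ (-4)` into `|x| ^ (-2)`.
  have hinner : ∀ x ∈ planeCone δ ∩ Metric.ball 0 r',
      ENNReal.ofReal k * V * ENNReal.ofReal (‖x‖ ^ (-2 : ℝ))
      ≤ ∫⁻ y in planeCone δ ∩ Metric.ball 0 r,
        ENNReal.ofReal (|g x - g y| ^ 2 / ‖x - y‖ ^ (((2 : ℕ) : ℝ) + 2 * σ)) := by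
    intro x hx
    have hx0 := norm_pos_of_mem_planeCone hx.1
    have hxr : ‖x‖ < r' := mem_ball_zero_iff.1 hx.2
    calc ENNReal.ofReal k * V * ENNReal.ofReal (‖x‖ ^ (-2 : ℝ))
        = ENNReal.ofReal (k * ‖x‖ ^ (-4 : ℝ))
          * volume (planeConeAnnulus δ (‖x‖ * M) (‖x‖ * (2 * M))) := by
          rw [volume_planeConeAnnulus_mul _ _ _ hx0, ← mul_assoc,
            ← ENNReal.ofReal_mul (by positivity), mul_right_comm,
            ← ENNReal.ofReal_mul hkpos.le, mul_assoc k, ← Real.rpow_two, ← Real.rpow_add hx0, ← hV]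
          norm_num
      _ = ∫⁻ _ in planeConeAnnulus δ (‖x‖ * M) (‖x‖ * (2 * M)),
          ENNReal.ofReal (k * ‖x‖ ^ (-4 : ℝ)) := (setLIntegral_const _ _).symm
      _ ≤ ∫⁻ y in planeConeAnnulus δ (‖x‖ * M) (‖x‖ * (2 * M)),
          ENNReal.ofReal (|g x - g y| ^ 2 / ‖x - y‖ ^ (((2 : ℕ) : ℝ) + 2 * σ)) :=
          setLIntegral_mono' (isOpen_planeConeAnnulus _ _ _).measurableSet fun y hy =>
            ENNReal.ofReal_le_ofReal (hpt x hx y hy)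
      _ ≤ _ := by
          refine lintegral_mono_set fun y hy => ⟨hy.1, mem_ball_zero_iff.2 (hy.2.2.trans ?_)⟩
          rwa [← lt_div_iff₀ (by positivity)]
  have hm : MeasurableSet (planeCone δ ∩ Metric.ball 0 r') :=
    ((isOpen_planeCone δ).inter Metric.isOpen_ball).measurableSet
  refine top_le_iff.1 ?_
  calc (⊤ : ENNReal) = ∫⁻ x in planeCone δ ∩ Metric.ball 0 r',
        ENNReal.ofReal k * V * ENNReal.ofReal (‖x‖ ^ (-2 : ℝ)) := by
        rw [lintegral_const_mul' _ _ (ENNReal.mul_ne_top ENNReal.ofReal_ne_top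
            (volume_planeConeAnnulus_lt_top _ _ _).ne),
          lintegral_planeCone_inter_ball_norm_rpow_neg_two hδ hr'0,
          ENNReal.mul_top (mul_ne_zero (ENNReal.ofReal_pos.2 hkpos).ne' hVpos.ne')]
    _ ≤ _ := setLIntegral_mono' hm hinner
    _ ≤ _ := lintegral_mono_set (Set.inter_subset_inter_right _ (Metric.ball_subset_ball hr'r))

theorem slobodeckijEnergy_congr_ae {d : ℕ} {σ : ℝ} {Ω : Set (EuclideanSpace ℝ (Fin d))}
    {f g : EuclideanSpace ℝ (Fin d) → ℝ} (h : f =ᵐ[volume.restrict Ω] g) :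
    slobodeckijEnergy σ Ω f = slobodeckijEnergy σ Ω g := by
  refine lintegral_congr_ae ?_
  filter_upwards [h] with x hx
  refine lintegral_congr_ae ?_
  filter_upwards [h] with y hy
  rw [hx, hy]

theorem slobodeckijEnergy_mono_set {d : ℕ} {σ : ℝ} {Ω Ω' : Set (EuclideanSpace ℝ (Fin d))}
    (h : Ω' ⊆ Ω) (g : EuclideanSpace ℝ (Fin d) → ℝ) :
    slobodeckijEnergy σ Ω' g ≤ slobodeckijEnergy σ Ω g :=
  (lintegral_mono fun _ => lintegral_mono_set h).trans (lintegral_mono_set h)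

/-! ### The eigenfunctions near the vertex of the sector -/

/-- In the open first quadrant `arg < tan arg = x 1 / x 0 < δ`. -/
theorem arg_toComplex_pos_of_mem_planeCone {δ : ℝ} (hδ : 0 < δ) {x : EuclideanSpace ℝ (Fin 2)}
    (hx : x ∈ planeCone δ) : 0 < (toComplex x).arg ∧ (toComplex x).arg < δ := by
  have h1 : 0 < (toComplex x).im := by rw [toComplex_apply]; exact hx.1
  have h2 : 0 < (toComplex x).re := by
    rw [toComplex_apply]; exact pos_of_mul_pos_right (hx.1.trans hx.2) hδ.le
  have h3 : (toComplex x).im < δ * (toComplex x).re := by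
    rw [toComplex_apply]; exact hx.2
  have hpos : 0 < (toComplex x).arg := by
    refine lt_of_le_of_ne (Complex.arg_nonneg_iff.2 h1.le) fun h => ?_
    exact h1.ne' (Complex.arg_eq_zero_iff.1 h.symm).2
  have hlt : (toComplex x).arg < Real.pi / 2 :=
    (abs_lt.1 (Complex.abs_arg_lt_pi_div_two_iff.2 (.inl h2))).2
  refine ⟨hpos, (Real.lt_tan hpos hlt).trans ?_⟩
  rwa [Complex.tan_arg, div_lt_iff₀ h2]

theorem planeCone_inter_ball_subset_circularSector {δ ω : ℝ} (hδ : 0 < δ) (h : δ ≤ ω) :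
    planeCone δ ∩ Metric.ball 0 1 ⊆ circularSector ω := by
  rintro x ⟨hx, hx1⟩
  obtain ⟨h1, h2⟩ := arg_toComplex_pos_of_mem_planeCone hδ hx
  refine ⟨‖x‖, (toComplex x).arg, norm_pos_of_mem_planeCone hx, mem_ball_zero_iff.1 hx1, h1,
    h2.trans_le h, ?_⟩
  rw [← toComplex.norm_map, Complex.norm_mul_cos_arg, Complex.norm_mul_sin_arg, toComplex_apply]
  ext i
  fin_cases i <;> rfl

/-- `J_ν(μ r) cos(ν φ)` is not in `H^s` of the sector if `ν` is not an integer and `s ≥ ν + 1`. -/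
theorem not_memSobolevSlobodeckij_besselJ_mul_cos {ω ν μ s : ℝ} (hω : 0 < ω) (hν : 0 ≤ ν)
    (hνn : ¬ ∃ n : ℕ, ν = n) (hμ : 0 < μ) (hs : ν + 1 ≤ s) :
    ¬ MemSobolevSlobodeckij s (circularSector ω)
      (fun x => besselJ ν (μ * ‖x‖) * Real.cos (ν * polarAngle x)) := by
  intro hmem
  set l := ⌊s⌋₊ with hl
  set a : ℝ := ν - l with ha
  have hls : (l : ℝ) ≤ s := Nat.floor_le (by linarith)
  have ha0 : a < 0 := by linarith [Nat.lt_floor_add_one s]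
  -- The first bound puts the cone, near the vertex, inside the sector; the second gives `|a arg z|
  -- ≤ 1`.
  set δ : ℝ := min ω (1 / (|a| + 1)) with hδ
  have hδ0 : 0 < δ := lt_min hω (by positivity)
  set Q : EuclideanSpace ℝ (Fin 2) → ℂ := fun x =>
    (FormalMultilinearSeries.ofScalarsSum (E := ℝ) (besselCoeff ν μ) (‖x‖ ^ 2) : ℝ) with hQdef
  have hQ : ContDiff ℝ (⊤ : ℕ∞) Q := Complex.ofRealCLM.contDiff.comp
    ((contDiff_ofScalarsSum_besselCoeff hν hμ).comp (contDiff_norm_sq ℝ))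
  have hQ0 : Q 0 = (besselCoeff ν μ 0 : ℝ) := by
    simp [hQdef, FormalMultilinearSeries.ofScalarsSum_zero]
  set U : EuclideanSpace ℝ (Fin 2) → ℝ := fun x => (toComplex x ^ (ν : ℂ) * Q x).re with hU
  have hslit : ∀ x ∈ planeCone δ, toComplex x ∈ Complex.slitPlane := fun x hx =>
    Complex.mem_slitPlane_iff.2 (.inr (by rw [toComplex_apply]; exact hx.1.ne'))
  have huU : Set.EqOn (fun x => besselJ ν (μ * ‖x‖) * Real.cos (ν * polarAngle x)) U
      (planeCone δ) := fun x hx => by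
    simp only [hU, hQdef]
    rw [Complex.re_mul_ofReal, Complex.cpow_ofReal_re, toComplex.norm_map,
      besselJ_mul hν hμ (norm_nonneg x),
      polarAngle_eq_arg (arg_toComplex_pos_of_mem_planeCone hδ0 hx).1.le, mul_comm ν]
    ring
  -- Non-integrality of `ν` enters here: no factor of `ν(ν - 1)⋯(ν - l + 1)` vanishes.
  obtain ⟨P, p, hP, hp, hP0, hE⟩ := exists_multiPartialDeriv_eqOn_re_cpow_mul
    (isOpen_planeCone δ) hslit l (fun i _ h => hνn ⟨i, h⟩) hQ (besselCoeff_ne_zero hν hμ 0) hQ0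
    (Set.eqOn_refl U _)
  obtain ⟨r₀, hr₀, c, hc, C, hC, hbd⟩ := exists_norm_rpow_bounds_re_cpow_mul a hP hp hP0
  set r : ℝ := min r₀ 1 with hr
  have hr0 : 0 < r := lt_min hr₀ one_pos
  have hr1 : r ≤ 1 := min_le_right _ _
  set Ω' := planeCone δ ∩ Metric.ball (0 : EuclideanSpace ℝ (Fin 2)) r with hΩ'
  have hΩ'o : IsOpen Ω' := (isOpen_planeCone δ).inter Metric.isOpen_ball
  have hsub : Ω' ⊆ circularSector ω :=
    (Set.inter_subset_inter_right _ (Metric.ball_subset_ball hr1)).trans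
      (planeCone_inter_ball_subset_circularSector hδ0 (min_le_left _ _))
  have hbounds : ∀ x ∈ Ω', c * ‖x‖ ^ a ≤ |multiPartialDeriv l (fun _ => 0) U x| ∧
      |multiPartialDeriv l (fun _ => 0) U x| ≤ C * ‖x‖ ^ a := fun x hx => by
    rw [hE hx.1]
    refine hbd x ((mem_ball_zero_iff.1 hx.2).trans_le (min_le_left _ _)) ?_
    obtain ⟨h1, h2⟩ := arg_toComplex_pos_of_mem_planeCone hδ0 hx.1
    have h3 : (toComplex x).arg ≤ 1 / (|a| + 1) := h2.le.trans (min_le_right _ _)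
    rw [le_div_iff₀ (by positivity)] at h3
    rw [abs_mul, abs_of_pos h1]
    linarith
  have hae : ∀ {g : EuclideanSpace ℝ (Fin 2) → ℝ}, IsWeakPartialDeriv (circularSector ω)
      (fun _ : Fin l => (0 : Fin 2))
      (fun x => besselJ ν (μ * ‖x‖) * Real.cos (ν * polarAngle x)) g →
      g =ᵐ[volume.restrict Ω'] multiPartialDeriv l (fun _ => 0) U := fun hg =>
    (ae_restrict_iff' hΩ'o.measurableSet).2 (hg.ae_eq_multiPartialDeriv hΩ'o hsub
      (contDiffOn_re_cpow_mul (fun x hx => hslit x hx.1) ν hQ)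
      (huU.mono Set.inter_subset_left))
  -- If `s = l`, then `ν + 1 ≤ l` gives `a ≤ -1` and the `L²` condition fails. Otherwise `ν + 1 ≤ s`
  -- reads `a + 1 ≤ s - l` and the Slobodeckij energy is infinite.
  by_cases hsl : s = l
  · obtain ⟨g, hg, hg2⟩ := hmem.1.2 l le_rfl fun _ => 0
    have h1 : MemLp (multiPartialDeriv l (fun _ => 0) U) 2 (volume.restrict Ω') :=
      (memLp_congr_ae (hae hg)).1 (hg2.mono_measure (Measure.restrict_mono_set _ hsub))
    have h2 := (hasFiniteIntegral_iff_ofReal (.of_forall fun x => sq_nonneg _)).1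
      h1.integrable_sq.2
    exact h2.ne (lintegral_sq_eq_top_of_norm_rpow_le hδ0 hr0 hr1 hc (by linarith)
      fun x hx => (hbounds x hx).1)
  · obtain ⟨g, hg, -, hg3⟩ := hmem.2 hsl fun _ => 0
    have h1 := (slobodeckijEnergy_mono_set hsub g).trans_lt hg3
    rw [slobodeckijEnergy_congr_ae (hae hg)] at h1
    exact h1.ne (slobodeckijEnergy_planeCone_eq_top hδ0 hr0 hr1 hc hC ha0
      (sub_pos.2 (lt_of_le_of_ne hls (Ne.symm hsl))) (by linarith) hbounds)

theorem lemma2 (ω : ℝ) (hω0 : 0 < ω) (hω1 : ω ≤ 2 * Real.pi) (k m : ℕ) (hm : 1 ≤ m) :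
    ((∀ s : ℝ, 0 ≤ s →
        MemSobolevSlobodeckij s (circularSector ω) (sectorEigenfunction ω k m)) ↔
      ∃ n : ℕ, angularFreq ω k = (n : ℝ)) ∧
    ((¬ ∃ n : ℕ, angularFreq ω k = (n : ℝ)) →
      ∀ s : ℝ, angularFreq ω k + 1 ≤ s →
        ¬ MemSobolevSlobodeckij s (circularSector ω) (sectorEigenfunction ω k m)) := by
  have hν : 0 ≤ angularFreq ω k := by
    unfold angularFreq
    positivity
  have hμ := besselZero_pos (angularFreq ω k) m
  have hsharp : (¬ ∃ n : ℕ, angularFreq ω k = (n : ℝ)) → ∀ s : ℝ, angularFreq ω k + 1 ≤ s →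
      ¬ MemSobolevSlobodeckij s (circularSector ω) (sectorEigenfunction ω k m) :=
    fun h s hs => not_memSobolevSlobodeckij_besselJ_mul_cos hω0 hν h hμ hs
  refine ⟨⟨fun h => ?_, ?_⟩, hsharp⟩
  · by_contra hn
    -- The single exponent `s = ν + 1` gives the contradiction.
    exact hsharp hn _ le_rfl (h _ (by linarith))
  · rintro ⟨n, hn⟩ s -
    have hsm : ContDiff ℝ (⊤ : ℕ∞) (sectorEigenfunction ω k m) := by
      rw [hn] at hμ
      have := contDiff_besselJ_mul_cos n hμ
      rw [← hn] at this
      exact this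
    exact hsm.memSobolevSlobodeckij s (circularSector_subset_ball ω)
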